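/- Consider a finite normal-form game: a finite set of players, each player $i$ having a finite nonempty action set $A_i$ and an arbitrary real payoff function $u_i$ on $\prod_j A_j$. For a mixed profile $\sigma$ let $U_i(a,\sigma_{-i})$ be the expected payoff of player $i$ from action $a\in A_i$ when the others independently play $\sigma_{-i}$, and for $\lambda\ge 0$ let the logit response be $$L_i^\lambda(\sigma)(a)=\frac{\exp(\lambda U_i(a,\sigma_{-i}))}{\sum_{a'\in A_i}\exp(\lambda U_i(a',\sigma_{-i}))}.$$ A logit quantal response equilibrium (QRE) at $\lambda$ is a mixed profile $\sigma$ with $\sigma_i=L_i^\lambda(\sigma)$ for all $i$. Then: (1) Existence. A QRE exists for every $\lambda\ge 0$. (2) Limits. For every $\varepsilon>0$ there is $\delta>0$ such that for all $0\le\lambda<\delta$ every QRE at $\lambda$ is within $\varepsilon$ (in the maximum norm) of the profile in which each player plays each action with probability $1/|A_i|$. For every $\varepsilon>0$ there is $M$ such that for all $\lambda\ge M$ every QRE at $\lambda$ is within $\varepsilon$ of some mixed Nash equilibrium; and if $\lambda_n\to\infty$, $\sigma^n$ is a QRE at $\lambda_n$ and $\sigma^n\to\tau$, then $\tau$ is a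 Nash equilibrium. (3) Monotonicity. Fix a mixed profile $\sigma$ and a player $i$. As functions of $\lambda\in[0,\infty)$, both the regret $\max_a U_i(a,\sigma_{-i})-\sum_a L_i^\lambda(\sigma)(a)\,U_i(a,\sigma_{-i})$ and the total variation distance from $L_i^\lambda(\sigma)$ to the set of mixed best responses to $\sigma_{-i}$ are nonincreasing; both are strictly decreasing if two actions of player $i$ have distinct expected payoffs against $\sigma_{-i}$. (4) Identifiability. Fix a mixed profile $\sigma$ and a player $i$. If $U_i(a,\sigma_{-i})>U_i(b,\sigma_{-i})$, then $\lambda\mapsto L_i^\lambda(\sigma)(a)/L_i^\lambda(\sigma)(b)$ is strictly increasing on $[0,\infty)$; and if two actions of player $i$ have distinct expected payoffs against $\sigma_{-i}$, then $\lambda\mapsto L_i^\lambda(\sigma)$ is injective on $[0,\infty)$. Consequently, if $\sigma$ is a QRE at $\lambda\ge0$ and $\sigma'$ a QRE at $\lambda'\ge0$, some player has two actions with distinct expected payoffs under $\sigma$, and $\sigma$ and $\sigma'$ induce the same probability distribution on action profiles, then $\lambda=\lambda'$. -/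

import Mathlib

open Filter Topology

namespace FiniteGame

variable {ι : Type*} {A : ι → Type*}
variable [Fintype ι] [DecidableEq ι] [∀ i, Fintype (A i)] [∀ i, DecidableEq (A i)]

/-- `σ` assigns to every player a mixed strategy, i.e. a probability vector on the actions. -/
def IsMixedProfile (σ : ∀ i, A i → ℝ) : Prop :=
  ∀ i, σ i ∈ stdSimplex ℝ (A i)

/-- The uniform profile: every player plays every action with the same probability. -/
noncomputable def uniformProfile : ∀ i, A i → ℝ :=
  fun i _ => 1 / (Fintype.card (A i) : ℝ)

/-- The probability that the action profile `b` is played when the players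
randomize independently according to `σ`. -/
noncomputable def playProb (σ : ∀ i, A i → ℝ) (b : ∀ i, A i) : ℝ :=
  ∏ j, σ j (b j)

/-- The expected payoff of player `i` under the mixed profile `σ`;
`u i b` is the payoff of player `i` at the pure action profile `b`. -/
noncomputable def expectedPayoff (u : ι → (∀ i, A i) → ℝ) (σ : ∀ i, A i → ℝ) (i : ι) : ℝ :=
  ∑ b : ∀ i, A i, playProb σ b * u i b

/-- The expected payoff of player `i` from the mixed strategy `x` against `σ₋ᵢ`. -/
noncomputable def mixedPayoff (u : ι → (∀ i, A i) → ℝ) (σ : ∀ i, A i → ℝ) (i : ι)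
    (x : A i → ℝ) : ℝ :=
  expectedPayoff u (Function.update σ i x) i

/-- The expected payoff `Uᵢ(a, σ₋ᵢ)` of player `i` from the pure action `a` against `σ₋ᵢ`. -/
noncomputable def actionPayoff (u : ι → (∀ i, A i) → ℝ) (σ : ∀ i, A i → ℝ) (i : ι)
    (a : A i) : ℝ :=
  mixedPayoff u σ i (Pi.single a 1)

/-- The logit quantal response of player `i` with rationality parameter `lam` to `σ₋ᵢ`. -/
noncomputable def logitResponse (u : ι → (∀ i, A i) → ℝ) (lam : ℝ) (σ : ∀ i, A i → ℝ) (i : ι)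
    (a : A i) : ℝ :=
  Real.exp (lam * actionPayoff u σ i a) / ∑ a' : A i, Real.exp (lam * actionPayoff u σ i a')

/-- A logit quantal response equilibrium: a mixed profile that is a fixed point of the
logit response map. -/
def IsLogitQRE (u : ι → (∀ i, A i) → ℝ) (lam : ℝ) (σ : ∀ i, A i → ℝ) : Prop :=
  IsMixedProfile σ ∧ Function.IsFixedPt (logitResponse u lam) σ

/-- Nash equilibrium in mixed strategies: no player gains by a unilateral mixed deviation. -/
def IsNash (u : ι → (∀ i, A i) → ℝ) (σ : ∀ i, A i → ℝ) : Prop :=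
  IsMixedProfile σ ∧
    ∀ i, ∀ x ∈ stdSimplex ℝ (A i), mixedPayoff u σ i x ≤ expectedPayoff u σ i

/-- The set of mixed best responses of player `i` to `σ₋ᵢ`. -/
def bestResponses (u : ι → (∀ i, A i) → ℝ) (σ : ∀ i, A i → ℝ) (i : ι) : Set (A i → ℝ) :=
  {x | x ∈ stdSimplex ℝ (A i) ∧
    ∀ y ∈ stdSimplex ℝ (A i), mixedPayoff u σ i y ≤ mixedPayoff u σ i x}

/-- The total variation distance of two mixed strategies. -/
noncomputable def tvDist {i : ι} (x y : A i → ℝ) : ℝ :=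
  (1 / 2) * ∑ a, |x a - y a|

/-- The total variation distance of the mixed strategy `x` of player `i` from the set of
best responses to `σ₋ᵢ`. -/
noncomputable def distToBestResponse (u : ι → (∀ i, A i) → ℝ) (σ : ∀ i, A i → ℝ) (i : ι)
    (x : A i → ℝ) : ℝ :=
  sInf ((fun y => tvDist x y) '' bestResponses u σ i)

/-- The regret of the mixed strategy `x` of player `i` against `σ₋ᵢ`: the payoff of a best
action minus the payoff of `x`. -/
noncomputable def regret (u : ι → (∀ i, A i) → ℝ) (σ : ∀ i, A i → ℝ) (i : ι)
    (x : A i → ℝ) : ℝ :=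
  (⨆ a : A i, actionPayoff u σ i a) - mixedPayoff u σ i x

end FiniteGame

/-!
The equilibria at `lam` are the fixed points of the logit response map, which is smooth on the
whole space `∀ i, A i → ℝ` of (not necessarily mixed) profiles and takes values in mixed profiles.
Existence therefore follows from Brouwer's theorem in the form
`exists_fixedPoint_of_contDiff_of_bounded`: a bounded `C¹` self-map of a finite-dimensional space
has a fixed point. After a cutoff the map may be taken to be some `G` of compact support, and one
considers `F_t x = x - t • G x`. For small `t ≥ 0` this maps a ball `B` containing the support
bijectively to itself with positive Jacobian determinant, so `∫_B φ (F_t x) * det (DF_t x) = ∫_B φ`.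
When `φ` is a polynomial in `‖x‖ ^ 2`, the left side is a polynomial in `t`, so the identity extends
to `t = 1`. If `F_1` had no zero, then for `φ x = (S ^ 2 - ‖x‖ ^ 2) ^ k` with `S` large the left
side would decay exponentially faster in `k` than the right side.

At `lam = 0` the logit response is uniform, and it depends jointly continuously on `lam` and on the
profile; compactness of the set of mixed profiles makes the convergence
uniform. For `lam > 0` no action
improves on the logit response by more than `|A i| / lam` (`le_logit_expectation_add`), so limits of
equilibria as `lam → ∞` are Nash, and compactness gives the uniform version.

Both monotonicity statements are instances of one covariance inequality
(`logit_expectation_mono`, `logit_expectation_strictMono`): the expectation under logit weights of a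
function `f` that is larger at actions of larger payoff is nondecreasing in `lam`. The regret is a
constant minus the expectation of the payoff, and the distance from the best responses is one minus
the probability of the set of payoff-maximizing actions (`distToBestResponse_eq`). Identification
rests on the ratio of two logit probabilities being `exp (lam * (U a - U b))`; the distribution of
play determines the profile through its marginals.
-/

/-! ### Fixed points of bounded `C¹` maps -/

open MeasureTheory Polynomial in
/-- If the integral of a family of polynomials of bounded degree, evaluated at `t`, is constant for
small `t > 0`, then it is constant. By Lagrange interpolation the value at `t` is a fixed linear
combination of values at small nodes, so neither the measurability nor the integrability of the
coefficients enters. -/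
theorem integral_eval_eq_of_forall_small {X : Type*} [MeasurableSpace X] {μ : Measure X}
    {N : ℕ} {p : X → ℝ[X]} (hp : ∀ x, (p x).natDegree ≤ N)
    (hint : ∀ t : ℝ, Integrable (fun x => (p x).eval t) μ) {c δ : ℝ} (hδ : 0 < δ)
    (h : ∀ t : ℝ, 0 < t → t < δ → ∫ x, (p x).eval t ∂μ = c) (t : ℝ) :
    ∫ x, (p x).eval t ∂μ = c := by
  set s := Finset.range (N + 1)
  set v : ℕ → ℝ := fun j => δ / (j + 2) with hv
  have hvs : Set.InjOn v s := by
    intro i _ j _ hij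
    have hi : (i : ℝ) + 2 ≠ 0 := by positivity
    have hj : (j : ℝ) + 2 ≠ 0 := by positivity
    simp only [hv] at hij
    rw [div_eq_div_iff hi hj] at hij
    have := mul_left_cancel₀ hδ.ne' hij
    exact_mod_cast (by linarith : (i : ℝ) = j)
  have heval : ∀ x, (p x).eval t = ∑ j ∈ s, (p x).eval (v j) * (Lagrange.basis s v j).eval t := by
    intro x
    have hd : (p x).degree < s.card := by
      refine lt_of_le_of_lt degree_le_natDegree ?_
      rw [Finset.card_range]
      exact_mod_cast Nat.lt_succ_of_le (hp x)
    conv_lhs => rw [Lagrange.eq_interpolate hvs hd]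
    simp [Lagrange.interpolate_apply, eval_finsetSum]
  have hsum : ∑ j ∈ s, (Lagrange.basis s v j).eval t = 1 := by
    rw [← eval_finsetSum, Lagrange.sum_basis hvs (by simp [s]), eval_one]
  calc ∫ x, (p x).eval t ∂μ
      = ∑ j ∈ s, (∫ x, (p x).eval (v j) ∂μ) * (Lagrange.basis s v j).eval t := by
        simp_rw [heval]
        rw [integral_finsetSum _ fun j _ => (hint _).mul_const _]
        simp_rw [integral_mul_const]
    _ = ∑ j ∈ s, c * (Lagrange.basis s v j).eval t := by
        refine Finset.sum_congr rfl fun j _ => ?_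
        have hj : (0 : ℝ) ≤ j := j.cast_nonneg
        rw [h (v j) (by positivity) (div_lt_self hδ (by linarith))]
    _ = c := by rw [← Finset.mul_sum, hsum, mul_one]

open Polynomial in
theorem exists_polynomial_det_one_sub_smul {E : Type*} [NormedAddCommGroup E] [NormedSpace ℝ E]
    [FiniteDimensional ℝ E] (A : E →L[ℝ] E) :
    ∃ p : ℝ[X], p.natDegree ≤ Module.finrank ℝ E ∧
      ∀ t : ℝ, p.eval t = (ContinuousLinearMap.id ℝ E - t • A).det := by
  let b := Module.finBasis ℝ E
  set M := LinearMap.toMatrix b b (A : E →ₗ[ℝ] E) with hM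
  refine ⟨((X : ℝ[X]) • (-M).map C + (1 : Matrix _ _ ℝ).map C).det, ?_, fun t => ?_⟩
  · simpa using natDegree_det_X_add_C_le (-M) 1
  · rw [ContinuousLinearMap.det, ← LinearMap.det_toMatrix b, ← coe_evalRingHom, RingHom.map_det]
    congr 1
    have : ((ContinuousLinearMap.id ℝ E - t • A : E →L[ℝ] E) : E →ₗ[ℝ] E)
        = LinearMap.id - t • (A : E →ₗ[ℝ] E) := rfl
    rw [this, map_sub, map_smul, LinearMap.toMatrix_id, ← hM]
    ext i j
    simp [Matrix.one_apply]
    split_ifs <;> simp <;> ring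

/-- A small Lipschitz perturbation of the identity that is supported in a ball is a bijection of
that ball. -/
theorem image_sub_smul_closedBall {E : Type*} [NormedAddCommGroup E] [NormedSpace ℝ E]
    [CompleteSpace E] {G : E → E} {C : NNReal} (hG : LipschitzWith C G) {R : ℝ}
    (hR : ∀ x, x ∉ Metric.closedBall (0 : E) R → G x = 0) {t : ℝ} (ht : 0 ≤ t) (htC : t * C < 1) :
    Function.Injective (fun x => x - t • G x) ∧
      (fun x => x - t • G x) '' Metric.closedBall 0 R = Metric.closedBall 0 R := by
  have hK : LipschitzWith (t.toNNReal * C) fun x => t • G x := by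
    refine LipschitzWith.of_dist_le_mul fun x y => ?_
    rw [dist_smul₀, Real.norm_of_nonneg ht, NNReal.coe_mul, Real.coe_toNNReal _ ht, mul_assoc]
    exact mul_le_mul_of_nonneg_left (hG.dist_le_mul x y) ht
  have hlt : t.toNNReal * C < 1 := by
    rw [← NNReal.coe_lt_coe, NNReal.coe_mul, Real.coe_toNNReal _ ht]; exact htC
  have hinj : Function.Injective (fun x => x - t • G x) := by
    intro x y hxy
    have h1 : x - y = t • G x - t • G y := by
      have : x - t • G x = y - t • G y := hxy
      rw [sub_eq_sub_iff_add_eq_add] at this ⊢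
      rw [this]; abel
    have h2 := hK.dist_le_mul x y
    rw [dist_eq_norm, dist_eq_norm, ← h1] at h2
    by_contra hne
    have h3 : 0 < ‖x - y‖ := norm_pos_iff.2 (sub_ne_zero.2 hne)
    have h4 : ((t.toNNReal * C : NNReal) : ℝ) < 1 := hlt
    nlinarith
  refine ⟨hinj, Set.Subset.antisymm ?_ ?_⟩
  · rintro _ ⟨x, hx, rfl⟩
    by_contra hy
    have h1 := hR _ hy
    have h2 : x - t • G x = x := hinj (by simp only [h1]; simp)
    exact hy (by simpa only [h2] using hx)
  · intro y hy
    have hc : ContractingWith (t.toNNReal * C) fun x => y + t • G x := by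
      refine ⟨hlt, ?_⟩
      simpa using (LipschitzWith.const y).add hK
    obtain ⟨x, hx⟩ : ∃ x, y + t • G x = x := ⟨_, hc.fixedPoint_isFixedPt⟩
    have hxy : x - t • G x = y := by nth_rewrite 1 [← hx]; simp
    refine ⟨x, ?_, hxy⟩
    by_contra hxB
    rw [hR x hxB] at hxy
    simp at hxy
    exact hxB (hxy ▸ hy)

open MeasureTheory Polynomial in
/-- The change of variables formula on a ball for `x ↦ x - G x`, with the signed determinant and
the integrand `(S ^ 2 - ‖y‖ ^ 2) ^ k`. The map need not be injective: both sides agree for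
`x ↦ x - t • G x` with `t > 0` small, and the left side is polynomial in `t`. -/
theorem setIntegral_comp_mul_det_eq {E : Type*} [NormedAddCommGroup E] [InnerProductSpace ℝ E]
    [FiniteDimensional ℝ E] [MeasurableSpace E] [BorelSpace E]
    {G : E → E} (hG : ContDiff ℝ 1 G) (hGc : HasCompactSupport G) {R : ℝ}
    (hR : ∀ x, x ∉ Metric.closedBall (0 : E) R → G x = 0) (S : ℝ) (k : ℕ) :
    ∫ x in Metric.closedBall (0 : E) R, (S ^ 2 - ‖x - G x‖ ^ 2) ^ k *
      (ContinuousLinearMap.id ℝ E - fderiv ℝ G x).det =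
    ∫ x in Metric.closedBall (0 : E) R, (S ^ 2 - ‖x‖ ^ 2) ^ k := by
  obtain ⟨C, hC⟩ := hG.lipschitzWith_of_hasCompactSupport hGc one_ne_zero
  have hcont' : Continuous (fderiv ℝ G) := hG.continuous_fderiv one_ne_zero
  have hcont : Continuous G := hG.continuous
  choose q hqdeg hq using fun x => exists_polynomial_det_one_sub_smul (fderiv ℝ G x)
  let n : E → ℝ[X] := fun x => Polynomial.C (S ^ 2 - ‖x‖ ^ 2) +
    Polynomial.C (2 * inner ℝ x (G x)) * X - Polynomial.C (‖G x‖ ^ 2) * X ^ 2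
  have hn : ∀ x t, (n x).eval t = S ^ 2 - ‖x - t • G x‖ ^ 2 := by
    intro x t
    rw [norm_sub_sq_real, inner_smul_right, norm_smul, mul_pow, Real.norm_eq_abs, sq_abs]
    simp [n]
    ring
  have hndeg : ∀ x, (n x).natDegree ≤ 2 := by
    intro x; simp only [n]; compute_degree
  let p : E → ℝ[X] := fun x => n x ^ k * q x
  have hp : ∀ x t, (p x).eval t = (S ^ 2 - ‖x - t • G x‖ ^ 2) ^ k *
      (ContinuousLinearMap.id ℝ E - t • fderiv ℝ G x).det := by
    intro x t; simp [p, hn, hq]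
  have hpdeg : ∀ x, (p x).natDegree ≤ k * 2 + Module.finrank ℝ E := fun x =>
    natDegree_mul_le_of_le (natDegree_pow_le_of_le k (hndeg x)) (hqdeg x)
  have hdet : ∀ t : ℝ, Continuous fun x => (ContinuousLinearMap.id ℝ E - t • fderiv ℝ G x).det :=
    fun t => ContinuousLinearMap.continuous_det.comp (by fun_prop)
  have hint : ∀ t : ℝ, IntegrableOn (fun x => (p x).eval t) (Metric.closedBall (0 : E) R) := by
    intro t
    simp_rw [hp]
    have := hdet t
    exact ContinuousOn.integrableOn_compact (isCompact_closedBall _ _)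
      (Continuous.continuousOn (by fun_prop))
  -- as `fderiv ℝ G` is bounded by `C`, this `η` works at all points of the ball simultaneously
  obtain ⟨η, hη, hpos⟩ : ∃ η > 0, ∀ B : E →L[ℝ] E,
      dist B (ContinuousLinearMap.id ℝ E) < η → 0 < B.det := by
    have h1 : ∀ᶠ B : E →L[ℝ] E in 𝓝 (ContinuousLinearMap.id ℝ E), 0 < B.det :=
      ContinuousLinearMap.continuous_det.continuousAt.eventually_const_lt
        (by simp [ContinuousLinearMap.det])
    exact Metric.eventually_nhds_iff.1 h1
  have hfd : ∀ x, ‖fderiv ℝ G x‖ ≤ C := fun x => norm_fderiv_le_of_lipschitz ℝ hC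
  -- for `t` below the bound `δ`, `t • G` is a contraction and the determinant is positive
  have key := integral_eval_eq_of_forall_small hpdeg hint
    (c := ∫ x in Metric.closedBall (0 : E) R, (S ^ 2 - ‖x‖ ^ 2) ^ k)
    (δ := min 1 η / (C + 1)) (by positivity) ?_ 1
  · simpa only [hp, one_smul] using key
  · intro t ht0 htδ
    have htC : t * (C + 1) < min 1 η := (lt_div_iff₀ (by positivity)).1 htδ
    have ht1 : t * C < 1 := by nlinarith [min_le_left 1 η, C.coe_nonneg]
    have ht2 : t * C < η := by nlinarith [min_le_right 1 η, C.coe_nonneg]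
    obtain ⟨hinj, himg⟩ := image_sub_smul_closedBall hC hR ht0.le ht1
    have hder : ∀ x ∈ Metric.closedBall (0 : E) R, HasFDerivWithinAt (fun x => x - t • G x)
        (ContinuousLinearMap.id ℝ E - t • fderiv ℝ G x) (Metric.closedBall (0 : E) R) x :=
      fun x _ => ((hasFDerivAt_id x).sub
        (((hG.differentiable one_ne_zero x).hasFDerivAt).const_smul t)).hasFDerivWithinAt
    have hcv := integral_image_eq_integral_abs_det_fderiv_smul volume
      Metric.isClosed_closedBall.measurableSet hder hinj.injOn
      (fun y => (S ^ 2 - ‖y‖ ^ 2) ^ k)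
    rw [himg] at hcv
    rw [hcv]
    refine integral_congr_ae (Eventually.of_forall fun x => ?_)
    have : 0 < (ContinuousLinearMap.id ℝ E - t • fderiv ℝ G x).det := by
      apply hpos
      rw [dist_eq_norm, sub_sub_cancel_left, norm_neg, norm_smul, Real.norm_of_nonneg ht0.le]
      exact lt_of_le_of_lt (mul_le_mul_of_nonneg_left (hfd x) ht0.le) ht2
    simp only [hp, abs_of_pos this, smul_eq_mul]
    ring

open MeasureTheory in
theorem exists_fixedPoint_of_hasCompactSupport {E : Type*} [NormedAddCommGroup E]
    [InnerProductSpace ℝ E] [FiniteDimensional ℝ E]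
    {G : E → E} (hG : ContDiff ℝ 1 G) (hGc : HasCompactSupport G) : ∃ x, G x = x := by
  borelize E
  by_contra! hne
  obtain ⟨R, hR0, hR⟩ : ∃ R : ℝ, 0 < R ∧ ∀ x, x ∉ Metric.closedBall (0 : E) R → G x = 0 := by
    obtain ⟨R, hR0, hR⟩ := hGc.isCompact.isBounded.subset_closedBall_lt 0 0
    exact ⟨R, hR0, fun x hx => image_eq_zero_of_notMem_tsupport fun h => hx (hR h)⟩
  set B := Metric.closedBall (0 : E) R with hB
  have hBc : IsCompact B := isCompact_closedBall _ _
  have hBne : B.Nonempty := ⟨0, by simp [hB, hR0.le]⟩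
  have hcont : Continuous G := hG.continuous
  have hF : Continuous fun x => ‖x - G x‖ := by fun_prop
  have hdet : Continuous fun x => (ContinuousLinearMap.id ℝ E - fderiv ℝ G x).det := by
    have := hG.continuous_fderiv one_ne_zero
    exact ContinuousLinearMap.continuous_det.comp (by fun_prop)
  obtain ⟨x₀, -, hx₀⟩ := hBc.exists_isMinOn hBne hF.continuousOn
  set c := ‖x₀ - G x₀‖ with hc
  have hc0 : 0 < c := norm_pos_iff.2 (sub_ne_zero.2 (hne x₀).symm)
  obtain ⟨S₀, hS₀⟩ := hBc.exists_bound_of_continuousOn hF.continuousOn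
  obtain ⟨D, hD⟩ := hBc.exists_bound_of_continuousOn hdet.continuousOn
  set S := max S₀ (max R c) with hS
  have hSR : R ≤ S := le_trans (le_max_left _ _) (le_max_right _ _)
  have hSc : c ≤ S := le_trans (le_max_right _ _) (le_max_right _ _)
  have hSF : ∀ x ∈ B, ‖x - G x‖ ≤ S := fun x hx =>
    (le_of_eq_of_le (by simp) (hS₀ x hx)).trans (le_max_left _ _)
  set r := min (c / 2) R with hr
  have hr0 : 0 < r := lt_min (by positivity) hR0
  have hrB : Metric.closedBall (0 : E) r ⊆ B :=
    Metric.closedBall_subset_closedBall (min_le_right _ _)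
  -- `(S ^ 2 - ‖y‖ ^ 2) ^ k` is at most `a ^ k` at the values `y` of `x ↦ x - G x` on `B`,
  -- and at least `b ^ k` on the ball of radius `r`
  set a := S ^ 2 - c ^ 2
  set b := S ^ 2 - (c / 2) ^ 2
  have ha : 0 ≤ a := by simp only [a]; nlinarith
  have hab : a < b := by simp only [a, b]; nlinarith
  have hV : 0 < volume.real (Metric.closedBall (0 : E) r) :=
    ENNReal.toReal_pos (Metric.measure_closedBall_pos _ _ hr0).ne'
      (isCompact_closedBall _ _).measure_lt_top.ne
  have hD0 : 0 ≤ D := (norm_nonneg _).trans (hD _ hBne.some_mem)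
  have main : ∀ k : ℕ, b ^ k * volume.real (Metric.closedBall (0 : E) r) ≤
      a ^ k * D * volume.real B := by
    intro k
    calc b ^ k * volume.real (Metric.closedBall (0 : E) r)
        = ∫ x in Metric.closedBall (0 : E) r, b ^ k := by
          rw [setIntegral_const, smul_eq_mul, mul_comm]
      _ ≤ ∫ x in Metric.closedBall (0 : E) r, (S ^ 2 - ‖x‖ ^ 2) ^ k := by
          refine setIntegral_mono_on (ContinuousOn.integrableOn_compact (isCompact_closedBall _ _)
            (by fun_prop)) (ContinuousOn.integrableOn_compact (isCompact_closedBall _ _)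
            (by fun_prop)) Metric.isClosed_closedBall.measurableSet fun x hx => ?_
          have hx' : ‖x‖ ≤ c / 2 := (mem_closedBall_zero_iff.1 hx).trans (min_le_left _ _)
          refine pow_le_pow_left₀ (ha.trans hab.le) ?_ k
          simp only [b]
          gcongr
      _ ≤ ∫ x in B, (S ^ 2 - ‖x‖ ^ 2) ^ k := by
          refine setIntegral_mono_set (ContinuousOn.integrableOn_compact hBc (by fun_prop)) ?_
            hrB.eventuallyLE
          refine (ae_restrict_iff' Metric.isClosed_closedBall.measurableSet).2
            (Eventually.of_forall fun x hx => ?_)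
          have hx' : ‖x‖ ≤ S := (mem_closedBall_zero_iff.1 hx).trans hSR
          exact pow_nonneg (sub_nonneg.2 (by gcongr)) k
      _ = ∫ x in B, (S ^ 2 - ‖x - G x‖ ^ 2) ^ k *
            (ContinuousLinearMap.id ℝ E - fderiv ℝ G x).det :=
          (setIntegral_comp_mul_det_eq hG hGc hR S k).symm
      _ ≤ a ^ k * D * volume.real B := by
          refine (Real.le_norm_self _).trans
            (norm_setIntegral_le_of_norm_le_const hBc.measure_lt_top fun x hx => ?_)
          have h1 : c ≤ ‖x - G x‖ := hx₀ hx
          have h2 := hSF x hx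
          have h3 : 0 ≤ S ^ 2 - ‖x - G x‖ ^ 2 := sub_nonneg.2 (by gcongr)
          rw [norm_mul, norm_pow, Real.norm_of_nonneg h3]
          refine mul_le_mul (pow_le_pow_left₀ h3 ?_ k) (hD x hx) (norm_nonneg _) (by positivity)
          simp only [a]
          gcongr
  have hb : 0 < b := ha.trans_lt hab
  have hlim : Tendsto (fun k : ℕ => (a / b) ^ k * (D * volume.real B)) atTop (𝓝 0) := by
    simpa using (tendsto_pow_atTop_nhds_zero_of_lt_one (by positivity)
      ((div_lt_one hb).2 hab)).mul_const (D * volume.real B)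
  refine hV.not_ge (ge_of_tendsto' hlim fun k => ?_)
  rw [div_pow, div_mul_eq_mul_div, le_div_iff₀ (by positivity), mul_comm, ← mul_assoc]
  exact main k

/-- A form of **Brouwer's fixed point theorem**: a bounded `C¹` self-map of a finite-dimensional
real normed space has a fixed point. -/
theorem exists_fixedPoint_of_contDiff_of_bounded {E : Type*} [NormedAddCommGroup E]
    [NormedSpace ℝ E] [FiniteDimensional ℝ E] {f : E → E} (hf : ContDiff ℝ 1 f)
    (hb : ∃ C, ∀ x, ‖f x‖ ≤ C) : ∃ x, f x = x := by
  let e := toEuclidean (E := E)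
  let T : E →L[ℝ] EuclideanSpace ℝ (Fin (Module.finrank ℝ E)) := e
  let g := fun y => e (f (e.symm y))
  have hg : ContDiff ℝ 1 g := e.contDiff.comp (hf.comp e.symm.contDiff)
  obtain ⟨C, hC⟩ := hb
  obtain ⟨K, hK0, hK⟩ : ∃ K, 0 < K ∧ ∀ y, ‖g y‖ ≤ K := by
    refine ⟨‖T‖ * C + 1, ?_, fun y => ?_⟩
    · have := (norm_nonneg _).trans (hC 0)
      positivity
    · have h1 := T.le_opNorm (f (e.symm y))
      have h2 := mul_le_mul_of_nonneg_left (hC (e.symm y)) (norm_nonneg T)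
      have h3 : ‖g y‖ = ‖T (f (e.symm y))‖ := rfl
      linarith
  -- the cutoff equals `1` on the ball of radius `K`, which contains every fixed point of `χ • g`
  let χ : ContDiffBump (0 : EuclideanSpace ℝ (Fin (Module.finrank ℝ E))) :=
    ⟨K, K + 1, hK0, by linarith⟩
  obtain ⟨y, hy⟩ := exists_fixedPoint_of_hasCompactSupport (G := fun y => χ y • g y)
    (χ.contDiff.smul hg) χ.hasCompactSupport.smul_right
  have hyK : ‖y‖ ≤ K := by
    rw [← hy, norm_smul, Real.norm_of_nonneg χ.nonneg]
    exact (mul_le_of_le_one_left (norm_nonneg _) χ.le_one).trans (hK y)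
  simp only [χ.one_of_mem_closedBall (mem_closedBall_zero_iff.2 hyK), one_smul] at hy
  exact ⟨e.symm y, by rw [← e.symm_apply_apply (f (e.symm y))]; exact congrArg e.symm hy⟩

/-! ### Logit weights -/

theorem logit_cross_nonneg {α : Type*} {U f : α → ℝ} (hf : ∀ a b, U a < U b → f a ≤ f b)
    {lam mu : ℝ} (h : lam ≤ mu) (a b : α) :
    0 ≤ (Real.exp (mu * U a) * Real.exp (lam * U b) - Real.exp (mu * U b) * Real.exp (lam * U a)) *
      (f a - f b) := by
  simp only [← Real.exp_add]
  rcases lt_trichotomy (U a) (U b) with hab | hab | hab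
  · refine mul_nonneg_of_nonpos_of_nonpos (sub_nonpos.2 (Real.exp_le_exp.2 ?_))
      (sub_nonpos.2 (hf a b hab))
    nlinarith
  · simp [hab]
  · refine mul_nonneg (sub_nonneg.2 (Real.exp_le_exp.2 ?_)) (sub_nonneg.2 (hf b a hab))
    nlinarith

theorem argmax_indicator_mono {α : Type*} {U : α → ℝ} {m : ℝ} (hm : IsGreatest (Set.range U) m)
    {a b : α} (hab : U a < U b) :
    (if U a = m then 1 else 0 : ℝ) ≤ if U b = m then 1 else 0 := by
  rw [if_neg (hab.trans_le (hm.2 ⟨b, rfl⟩)).ne]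
  split_ifs <;> norm_num

section LogitChoice
variable {α : Type*} [Fintype α]

theorem logit_ratio (U : α → ℝ) (lam : ℝ) [Nonempty α] (a b : α) :
    (Real.exp (lam * U a) / ∑ c, Real.exp (lam * U c)) /
      (Real.exp (lam * U b) / ∑ c, Real.exp (lam * U c)) = Real.exp (lam * (U a - U b)) := by
  have : 0 < ∑ c, Real.exp (lam * U c) :=
    Finset.sum_pos (fun _ _ => Real.exp_pos _) Finset.univ_nonempty
  rw [div_div_div_cancel_right₀ this.ne', ← Real.exp_sub, mul_sub]

/-- The difference of two logit expectations of `f`, cleared of denominators, as a symmetric double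
sum whose terms have a sign by `logit_cross_nonneg`. -/
theorem logit_cross_sum (U f : α → ℝ) (lam mu : ℝ) :
    2 * ((∑ a, Real.exp (mu * U a) * f a) * (∑ b, Real.exp (lam * U b)) -
      (∑ a, Real.exp (lam * U a) * f a) * (∑ b, Real.exp (mu * U b))) =
    ∑ a, ∑ b, (Real.exp (mu * U a) * Real.exp (lam * U b) -
      Real.exp (mu * U b) * Real.exp (lam * U a)) * (f a - f b) := by
  have e : ∀ a b, (Real.exp (mu * U a) * Real.exp (lam * U b) -
      Real.exp (mu * U b) * Real.exp (lam * U a)) * (f a - f b) =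
      ((Real.exp (mu * U a) * f a) * Real.exp (lam * U b) -
        (Real.exp (lam * U a) * f a) * Real.exp (mu * U b)) +
      (Real.exp (lam * U a) * (Real.exp (mu * U b) * f b) -
        Real.exp (mu * U a) * (Real.exp (lam * U b) * f b)) := fun a b => by ring
  simp_rw [e, Finset.sum_add_distrib, Finset.sum_sub_distrib, ← Finset.sum_mul_sum]
  ring

/-- The logit expectation of `f` is nondecreasing in the parameter if `f` does not decrease with the
payoff `U`. Nothing is required of `f` at actions of equal payoff. -/
theorem logit_expectation_mono [Nonempty α] {U f : α → ℝ} (hf : ∀ a b, U a < U b → f a ≤ f b) :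
    Monotone fun lam : ℝ => ∑ a, Real.exp (lam * U a) / (∑ c, Real.exp (lam * U c)) * f a := by
  intro lam mu h
  have hZ : ∀ t : ℝ, 0 < ∑ c, Real.exp (t * U c) := fun t =>
    Finset.sum_pos (fun _ _ => Real.exp_pos _) Finset.univ_nonempty
  simp only [div_mul_eq_mul_div, ← Finset.sum_div]
  rw [div_le_div_iff₀ (hZ _) (hZ _)]
  have := logit_cross_sum U f lam mu
  have h2 : 0 ≤ ∑ a, ∑ b, (Real.exp (mu * U a) * Real.exp (lam * U b) -
      Real.exp (mu * U b) * Real.exp (lam * U a)) * (f a - f b) :=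
    Finset.sum_nonneg fun a _ => Finset.sum_nonneg fun b _ => logit_cross_nonneg hf h a b
  linarith

theorem logit_expectation_strictMono [Nonempty α] {U f : α → ℝ}
    (hf : ∀ a b, U a < U b → f a ≤ f b) (hs : ∃ a b, U a < U b ∧ f a < f b) :
    StrictMono fun lam : ℝ => ∑ a, Real.exp (lam * U a) / (∑ c, Real.exp (lam * U c)) * f a := by
  intro lam mu h
  have hZ : ∀ t : ℝ, 0 < ∑ c, Real.exp (t * U c) := fun t =>
    Finset.sum_pos (fun _ _ => Real.exp_pos _) Finset.univ_nonempty
  simp only [div_mul_eq_mul_div, ← Finset.sum_div]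
  rw [div_lt_div_iff₀ (hZ _) (hZ _)]
  have := logit_cross_sum U f lam mu
  obtain ⟨a₀, b₀, hU, hfab⟩ := hs
  have h2 : 0 < ∑ a, ∑ b, (Real.exp (mu * U a) * Real.exp (lam * U b) -
      Real.exp (mu * U b) * Real.exp (lam * U a)) * (f a - f b) := by
    refine Finset.sum_pos' (fun a _ => Finset.sum_nonneg fun b _ => logit_cross_nonneg hf h.le a b)
      ⟨a₀, Finset.mem_univ _, Finset.sum_pos' (fun b _ => logit_cross_nonneg hf h.le a₀ b)
        ⟨b₀, Finset.mem_univ _, ?_⟩⟩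
    refine mul_pos_of_neg_of_neg (sub_neg.2 ?_) (sub_neg.2 hfab)
    rw [← Real.exp_add, ← Real.exp_add, Real.exp_lt_exp]
    nlinarith
  linarith

/-- The logit choice is `card α / lam`-optimal: each action contributes at most `1 / lam` to the
regret, because `y * exp (-lam * y) ≤ 1 / lam`. -/
theorem le_logit_expectation_add [Nonempty α] (U : α → ℝ) {lam : ℝ} (h : 0 < lam) (b : α) :
    U b ≤ ∑ a, Real.exp (lam * U a) / (∑ c, Real.exp (lam * U c)) * U a +
      Fintype.card α / lam := by
  set Z := ∑ c, Real.exp (lam * U c) with hZdef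
  have hZ : 0 < Z := Finset.sum_pos (fun _ _ => Real.exp_pos _) Finset.univ_nonempty
  have hbZ : Real.exp (lam * U b) ≤ Z :=
    Finset.single_le_sum (f := fun c => Real.exp (lam * U c)) (fun _ _ => (Real.exp_pos _).le)
      (Finset.mem_univ b)
  have hsum : ∑ a, Real.exp (lam * U a) / Z = 1 := by rw [← Finset.sum_div, div_self hZ.ne']
  have hterm : ∀ a, Real.exp (lam * U a) / Z * (U b - U a) ≤ 1 / lam := by
    intro a
    rcases le_total (U b) (U a) with hle | hle
    · exact (mul_nonpos_of_nonneg_of_nonpos (by positivity) (sub_nonpos.2 hle)).trans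
        (by positivity)
    · have h1 : lam * (U b - U a) * Real.exp (lam * U a) ≤ Z := by
        calc lam * (U b - U a) * Real.exp (lam * U a)
            ≤ Real.exp (lam * (U b - U a)) * Real.exp (lam * U a) := by
              gcongr
              linarith [Real.add_one_le_exp (lam * (U b - U a))]
          _ = Real.exp (lam * U b) := by rw [← Real.exp_add]; ring_nf
          _ ≤ Z := hbZ
      rw [div_mul_eq_mul_div, div_le_div_iff₀ hZ h]
      linarith
  have h3 : ∑ a, Real.exp (lam * U a) / Z * (U b - U a) ≤ Fintype.card α / lam := by
    refine (Finset.sum_le_sum fun a _ => hterm a).trans (le_of_eq ?_)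
    simp [div_eq_mul_inv]
  simp only [mul_sub, Finset.sum_sub_distrib, ← Finset.sum_mul, hsum] at h3
  linarith

/-- A probability vector supported in `s` is at total variation distance at least `1 - x(s)`
from `x`. -/
theorem half_sum_abs_sub_ge {x y : α → ℝ} (hx : x ∈ stdSimplex ℝ α)
    (hy : y ∈ stdSimplex ℝ α) {s : Finset α} (hs : ∀ a ∉ s, y a = 0) :
    1 - ∑ a ∈ s, x a ≤ 1 / 2 * ∑ a, |x a - y a| := by
  classical
  have hys : ∑ a ∈ s, y a = 1 := by
    rw [← hy.2]; exact Finset.sum_subset (Finset.subset_univ s) fun a _ ha => hs a ha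
  have hxs := Finset.sum_add_sum_compl s x
  have hys' := Finset.sum_add_sum_compl s y
  rw [hx.2] at hxs
  rw [hy.2] at hys'
  have h1 : ∑ a ∈ s, (y a - x a) ≤ ∑ a ∈ s, |x a - y a| :=
    Finset.sum_le_sum fun a _ => by rw [abs_sub_comm]; exact le_abs_self _
  have h2 : ∑ a ∈ sᶜ, (x a - y a) ≤ ∑ a ∈ sᶜ, |x a - y a| :=
    Finset.sum_le_sum fun a _ => le_abs_self _
  rw [← Finset.sum_add_sum_compl s fun a => |x a - y a|]
  rw [Finset.sum_sub_distrib] at h1 h2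
  linarith

/-- The lower bound of `half_sum_abs_sub_ge` is attained: move the mass of `x` outside `s` to a
point of `s`. -/
theorem exists_half_sum_abs_sub_eq {x : α → ℝ} (hx : x ∈ stdSimplex ℝ α) {s : Finset α}
    (hs : s.Nonempty) : ∃ y ∈ stdSimplex ℝ α, (∀ a ∉ s, y a = 0) ∧
      1 / 2 * ∑ a, |x a - y a| = 1 - ∑ a ∈ s, x a := by
  classical
  obtain ⟨a₀, ha₀⟩ := hs
  have hxs := Finset.sum_add_sum_compl s x
  rw [hx.2] at hxs
  have hm : 0 ≤ 1 - ∑ a ∈ s, x a := by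
    have := Finset.sum_nonneg fun a (_ : a ∈ sᶜ) => hx.1 a
    linarith
  set m := 1 - ∑ a ∈ s, x a with hmdef
  let y : α → ℝ := fun a => if a ∈ s then x a + (if a = a₀ then m else 0) else 0
  have hyc : ∀ a ∉ s, y a = 0 := fun a ha => by simp [y, ha]
  have hys : ∀ a ∈ s, y a = x a + (if a = a₀ then m else 0) := fun a ha => by simp [y, ha]
  refine ⟨y, ⟨fun a => ?_, ?_⟩, hyc, ?_⟩
  · have := hx.1 a
    simp only [y]
    split_ifs <;> positivity
  · rw [← Finset.sum_subset (Finset.subset_univ s) fun a _ ha => hyc a ha,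
      Finset.sum_congr rfl hys, Finset.sum_add_distrib, Finset.sum_ite_eq' s a₀]
    simp only [ha₀, if_true, hmdef]
    ring
  · rw [← Finset.sum_add_sum_compl s fun a => |x a - y a|]
    have h1 : ∑ a ∈ s, |x a - y a| = m := by
      rw [← Finset.sum_eq_single_of_mem (f := fun a => if a = a₀ then m else 0) a₀ ha₀
        (fun b _ hb => if_neg hb) |>.trans (if_pos rfl)]
      refine Finset.sum_congr rfl fun a ha => ?_
      rw [hys a ha, sub_add_cancel_left, abs_neg, abs_of_nonneg]
      split_ifs <;> simp [hm]
    have h2 : ∑ a ∈ sᶜ, |x a - y a| = m := by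
      rw [hmdef, ← hxs, add_sub_cancel_left]
      refine Finset.sum_congr rfl fun a ha => ?_
      rw [hyc a (Finset.mem_compl.1 ha), sub_zero, abs_of_nonneg (hx.1 a)]
    rw [h1, h2]; ring

end LogitChoice

/-! ### Payoffs and best responses -/

namespace FiniteGame

variable {ι : Type*} {A : ι → Type*}

theorem isCompact_setOf_isMixedProfile [∀ i, Fintype (A i)] :
    IsCompact {σ : ∀ i, A i → ℝ | IsMixedProfile σ} := by
  have : {σ : ∀ i, A i → ℝ | IsMixedProfile σ} = Set.univ.pi fun i => stdSimplex ℝ (A i) := by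
    ext σ; simp [IsMixedProfile]
  rw [this]
  exact isCompact_univ_pi fun i => isCompact_stdSimplex ℝ (A i)

variable [Fintype ι] [DecidableEq ι]

theorem playProb_update (σ : ∀ i, A i → ℝ) (i : ι) (x : A i → ℝ) (b : ∀ i, A i) :
    playProb (Function.update σ i x) b = x (b i) * ∏ j ∈ Finset.univ.erase i, σ j (b j) := by
  rw [playProb, ← Finset.mul_prod_erase _ _ (Finset.mem_univ i), Function.update_self]
  congr 1
  refine Finset.prod_congr rfl fun j hj => ?_
  rw [Function.update_of_ne (Finset.ne_of_mem_erase hj)]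

variable [∀ i, Fintype (A i)]

theorem expectedPayoff_eq_mixedPayoff (u : ι → (∀ i, A i) → ℝ) (σ : ∀ i, A i → ℝ) (i : ι) :
    expectedPayoff u σ i = mixedPayoff u σ i (σ i) := by
  rw [mixedPayoff, Function.update_eq_self]

variable [∀ i, DecidableEq (A i)]

theorem mixedPayoff_eq_sum (u : ι → (∀ i, A i) → ℝ) (σ : ∀ i, A i → ℝ) (i : ι) (x : A i → ℝ) :
    mixedPayoff u σ i x = ∑ a, x a * actionPayoff u σ i a := by
  simp only [actionPayoff, mixedPayoff, expectedPayoff, playProb_update, Finset.mul_sum]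
  rw [Finset.sum_comm]
  refine Finset.sum_congr rfl fun b _ => ?_
  rw [Finset.sum_eq_single (b i)]
  · simp [mul_assoc]
  · intro a _ ha
    simp [ha.symm]
  · simp

theorem contDiff_actionPayoff (u : ι → (∀ i, A i) → ℝ) (i : ι) (a : A i) :
    ContDiff ℝ 1 fun σ : ∀ i, A i → ℝ => actionPayoff u σ i a := by
  simp only [actionPayoff, mixedPayoff, expectedPayoff, playProb_update]
  refine ContDiff.sum fun b _ => ContDiff.mul (contDiff_const.mul ?_) contDiff_const
  exact contDiff_prod fun j _ => contDiff_pi.1 (contDiff_pi.1 contDiff_id j) (b j)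

theorem continuous_actionPayoff (u : ι → (∀ i, A i) → ℝ) (i : ι) (a : A i) :
    Continuous fun σ : ∀ i, A i → ℝ => actionPayoff u σ i a :=
  (contDiff_actionPayoff u i a).continuous

theorem regret_logitResponse (u : ι → (∀ i, A i) → ℝ) (σ : ∀ i, A i → ℝ) (i : ι) (lam : ℝ) :
    regret u σ i (logitResponse u lam σ i) = (⨆ a, actionPayoff u σ i a) -
      ∑ a, Real.exp (lam * actionPayoff u σ i a) /
        (∑ c, Real.exp (lam * actionPayoff u σ i c)) * actionPayoff u σ i a := by
  rw [regret, mixedPayoff_eq_sum]; rfl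

/-- A mixed strategy is a best response iff it is supported on the actions of maximal payoff. -/
theorem mem_bestResponses_iff (u : ι → (∀ i, A i) → ℝ) (σ : ∀ i, A i → ℝ) (i : ι) {m : ℝ}
    (hm : IsGreatest (Set.range (actionPayoff u σ i)) m) (x : A i → ℝ) :
    x ∈ bestResponses u σ i ↔
      x ∈ stdSimplex ℝ (A i) ∧ ∀ a, actionPayoff u σ i a ≠ m → x a = 0 := by
  obtain ⟨⟨a₀, ha₀⟩, hub⟩ := hm
  have hle : ∀ a, actionPayoff u σ i a ≤ m := fun a => hub ⟨a, rfl⟩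
  have hbound : ∀ y ∈ stdSimplex ℝ (A i),
      ∑ a, y a * (m - actionPayoff u σ i a) = m - mixedPayoff u σ i y := by
    intro y hy
    rw [mixedPayoff_eq_sum]
    simp only [mul_sub, Finset.sum_sub_distrib, ← Finset.sum_mul, hy.2, one_mul]
  have hnn : ∀ y ∈ stdSimplex ℝ (A i), ∀ a, 0 ≤ y a * (m - actionPayoff u σ i a) :=
    fun y hy a => mul_nonneg (hy.1 a) (sub_nonneg.2 (hle a))
  refine and_congr_right fun hx => ⟨fun h a ha => ?_, fun h y hy => ?_⟩
  · have h1 := h _ (single_mem_stdSimplex ℝ a₀)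
    change actionPayoff u σ i a₀ ≤ _ at h1
    have h2 : ∑ a, x a * (m - actionPayoff u σ i a) = 0 :=
      le_antisymm (by rw [hbound x hx]; linarith) (Finset.sum_nonneg fun a _ => hnn x hx a)
    have h3 := (Finset.sum_eq_zero_iff_of_nonneg fun a _ => hnn x hx a).1 h2 a (Finset.mem_univ a)
    exact (mul_eq_zero.1 h3).resolve_right (sub_ne_zero.2 ha.symm)
  · have h1 : ∑ a, x a * (m - actionPayoff u σ i a) = 0 := by
      refine Finset.sum_eq_zero fun a _ => ?_
      by_cases ha : actionPayoff u σ i a = m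
      · simp [ha]
      · simp [h a ha]
    have h2 : 0 ≤ ∑ a, y a * (m - actionPayoff u σ i a) := Finset.sum_nonneg fun a _ => hnn y hy a
    rw [hbound x hx] at h1
    rw [hbound y hy] at h2
    linarith

/-- The total variation distance from the best responses is one minus the probability of the set of
actions of maximal payoff. -/
theorem distToBestResponse_eq (u : ι → (∀ i, A i) → ℝ) (σ : ∀ i, A i → ℝ) (i : ι) {m : ℝ}
    (hm : IsGreatest (Set.range (actionPayoff u σ i)) m) {x : A i → ℝ}
    (hx : x ∈ stdSimplex ℝ (A i)) :
    distToBestResponse u σ i x = 1 - ∑ a, x a * if actionPayoff u σ i a = m then 1 else 0 := by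
  classical
  set s := Finset.univ.filter fun a => actionPayoff u σ i a = m with hs
  have hsum : ∑ a, x a * (if actionPayoff u σ i a = m then 1 else 0) = ∑ a ∈ s, x a := by
    simp [hs, Finset.sum_filter]
  have hmem : ∀ y, y ∈ bestResponses u σ i ↔ y ∈ stdSimplex ℝ (A i) ∧ ∀ a ∉ s, y a = 0 := by
    intro y
    simp [mem_bestResponses_iff u σ i hm, hs]
  have hne : s.Nonempty := by
    obtain ⟨a₀, ha₀⟩ := hm.1
    exact ⟨a₀, by simp [hs, ha₀]⟩
  rw [hsum]
  refine IsLeast.csInf_eq ⟨?_, ?_⟩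
  · obtain ⟨y, hy, hys, heq⟩ := exists_half_sum_abs_sub_eq hx hne
    exact ⟨y, (hmem y).2 ⟨hy, hys⟩, heq⟩
  · rintro _ ⟨y, hy, rfl⟩
    exact half_sum_abs_sub_ge hx ((hmem y).1 hy).1 ((hmem y).1 hy).2

/-- The marginal on player `i` of the distribution of play is `σ i`. -/
theorem sum_playProb_of_eq {σ : ∀ i, A i → ℝ} (hσ : IsMixedProfile σ) (i : ι) (a : A i) :
    ∑ b : ∀ i, A i, (if b i = a then playProb σ b else 0) = σ i a := by
  have h1 : ∀ b : ∀ i, A i, (if b i = a then playProb σ b else 0) =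
      ∏ j, Function.update σ i (Pi.single a (σ i a)) j (b j) := by
    intro b
    have := playProb_update σ i (Pi.single a (σ i a)) b
    rw [playProb] at this
    rw [this]
    split_ifs with h
    · rw [playProb, ← Finset.mul_prod_erase _ _ (Finset.mem_univ i), h, Pi.single_eq_same]
    · rw [Pi.single_eq_of_ne h, zero_mul]
  simp_rw [h1]
  rw [← Fintype.prod_sum, Finset.prod_eq_single i]
  · simp
  · intro j _ hj
    rw [Function.update_of_ne hj, (hσ j).2]
  · simp

theorem IsMixedProfile.eq_of_playProb_eq {σ σ' : ∀ i, A i → ℝ} (hσ : IsMixedProfile σ)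
    (hσ' : IsMixedProfile σ') (h : ∀ b, playProb σ b = playProb σ' b) : σ = σ' := by
  funext i a
  rw [← sum_playProb_of_eq hσ, ← sum_playProb_of_eq hσ']
  simp only [h]

/-! ### The logit response map and its equilibria -/

variable [∀ i, Nonempty (A i)]

theorem sum_exp_pos (u : ι → (∀ i, A i) → ℝ) (lam : ℝ) (σ : ∀ i, A i → ℝ) (i : ι) :
    0 < ∑ a : A i, Real.exp (lam * actionPayoff u σ i a) :=
  Finset.sum_pos (fun _ _ => Real.exp_pos _) Finset.univ_nonempty

theorem isMixedProfile_logitResponse (u : ι → (∀ i, A i) → ℝ) (lam : ℝ) (σ : ∀ i, A i → ℝ) :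
    IsMixedProfile (logitResponse u lam σ) := fun i =>
  ⟨fun a => div_nonneg (Real.exp_pos _).le (sum_exp_pos u lam σ i).le, by
    simp only [logitResponse]
    rw [← Finset.sum_div, div_self (sum_exp_pos u lam σ i).ne']⟩

theorem contDiff_logitResponse (u : ι → (∀ i, A i) → ℝ) (lam : ℝ) :
    ContDiff ℝ 1 (logitResponse u lam) := by
  refine contDiff_pi.2 fun i => contDiff_pi.2 fun a => ?_
  have h := contDiff_actionPayoff u i
  exact ContDiff.div (by fun_prop) (ContDiff.sum fun a _ => by fun_prop)
    fun σ => (sum_exp_pos u lam σ i).ne'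

/-- Existence holds for every real parameter: boundedness and smoothness of the logit response on
all of `∀ i, A i → ℝ` allow Brouwer's theorem without restricting to mixed profiles. -/
theorem exists_isLogitQRE (u : ι → (∀ i, A i) → ℝ) (lam : ℝ) : ∃ σ, IsLogitQRE u lam σ := by
  obtain ⟨σ, hσ⟩ := exists_fixedPoint_of_contDiff_of_bounded (contDiff_logitResponse u lam)
    ⟨1, fun σ => (pi_norm_le_iff_of_nonneg zero_le_one).2 fun i =>
      (pi_norm_le_iff_of_nonneg zero_le_one).2 fun a => by
        have h := mem_Icc_of_mem_stdSimplex (isMixedProfile_logitResponse u lam σ i) a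
        rw [Real.norm_of_nonneg h.1]
        exact h.2⟩
  exact ⟨σ, hσ ▸ isMixedProfile_logitResponse u lam σ, hσ⟩

theorem IsLogitQRE.exists_forall_abs_sub_uniformProfile_lt (u : ι → (∀ i, A i) → ℝ) {ε : ℝ}
    (hε : 0 < ε) :
    ∃ δ : ℝ, 0 < δ ∧ ∀ lam : ℝ, 0 ≤ lam → lam < δ → ∀ σ : ∀ i, A i → ℝ, IsLogitQRE u lam σ →
      ∀ i, ∀ a : A i, |σ i a - uniformProfile i a| < ε := by
  have key : ∀ᶠ lam in 𝓝 (0 : ℝ), ∀ σ ∈ {σ : ∀ i, A i → ℝ | IsMixedProfile σ},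
      ∀ i, ∀ a : A i, |logitResponse u lam σ i a - uniformProfile i a| < ε := by
    refine isCompact_setOf_isMixedProfile.eventually_forall_of_forall_eventually fun σ _ => ?_
    refine eventually_all.2 fun i => eventually_all.2 fun a => ?_
    have hc : Continuous fun z : ℝ × (∀ i, A i → ℝ) =>
        |logitResponse u z.1 z.2 i a - uniformProfile i a| := by
      have h := continuous_actionPayoff u i
      have h' : ∀ a, Continuous fun z : ℝ × (∀ i, A i → ℝ) => actionPayoff u z.2 i a :=
        fun a => (h a).comp continuous_snd
      unfold logitResponse
      refine ((Continuous.div ?_ ?_ fun z : ℝ × (∀ i, A i → ℝ) =>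
        (sum_exp_pos u z.1 z.2 i).ne').sub
        continuous_const).abs
      · fun_prop
      · fun_prop
    refine hc.continuousAt.eventually_lt_const ?_
    simpa [logitResponse, uniformProfile] using hε
  obtain ⟨δ, hδ, h⟩ := Metric.eventually_nhds_iff.1 key
  refine ⟨δ, hδ, fun lam h0 hlt σ hσ i a => ?_⟩
  have := h (y := lam) (by rwa [Real.dist_0_eq_abs, abs_of_nonneg h0]) σ hσ.1 i a
  rwa [hσ.2.eq] at this

theorem IsLogitQRE.actionPayoff_le {u : ι → (∀ i, A i) → ℝ} {lam : ℝ} {σ : ∀ i, A i → ℝ}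
    (h : IsLogitQRE u lam σ) (hlam : 0 < lam) (i : ι) (b : A i) :
    actionPayoff u σ i b ≤
      ∑ a, σ i a * actionPayoff u σ i a + Fintype.card (A i) / lam := by
  have h1 : ∀ a, σ i a = Real.exp (lam * actionPayoff u σ i a) /
      ∑ a', Real.exp (lam * actionPayoff u σ i a') := fun a => by
    conv_lhs => rw [← h.2.eq]
    rfl
  have h2 := le_logit_expectation_add (actionPayoff u σ i) hlam b
  simpa only [← h1] using h2

theorem isNash_of_tendsto {u : ι → (∀ i, A i) → ℝ} {l : ℕ → ℝ} {s : ℕ → ∀ i, A i → ℝ}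
    {τ : ∀ i, A i → ℝ} (hl : Tendsto l atTop atTop) (hs : ∀ n, IsLogitQRE u (l n) (s n))
    (hτ : Tendsto s atTop (𝓝 τ)) : IsNash u τ := by
  have hmix : IsMixedProfile τ := (isCompact_setOf_isMixedProfile (A := A)).isClosed.mem_of_tendsto
    hτ (Eventually.of_forall fun n => (hs n).1)
  refine ⟨hmix, fun i x hx => ?_⟩
  have hb : ∀ b, actionPayoff u τ i b ≤ ∑ a, τ i a * actionPayoff u τ i a := by
    intro b
    have hU := continuous_actionPayoff u i
    have hcont : Continuous fun σ : ∀ i, A i → ℝ => ∑ a, σ i a * actionPayoff u σ i a := by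
      fun_prop
    have hr : Tendsto (fun n => ∑ a, s n i a * actionPayoff u (s n) i a +
        Fintype.card (A i) / l n) atTop (𝓝 (∑ a, τ i a * actionPayoff u τ i a + 0)) :=
      ((hcont.tendsto τ).comp hτ).add (hl.const_div_atTop _)
    rw [add_zero] at hr
    refine le_of_tendsto_of_tendsto (((hU b).tendsto τ).comp hτ) hr ?_
    filter_upwards [hl.eventually_gt_atTop 0] with n hn
    exact (hs n).actionPayoff_le hn i b
  rw [expectedPayoff_eq_mixedPayoff, mixedPayoff_eq_sum, mixedPayoff_eq_sum]
  calc ∑ a, x a * actionPayoff u τ i a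
      ≤ ∑ a, x a * ∑ a', τ i a' * actionPayoff u τ i a' :=
        Finset.sum_le_sum fun a _ => mul_le_mul_of_nonneg_left (hb a) (hx.1 a)
    _ = ∑ a', τ i a' * actionPayoff u τ i a' := by rw [← Finset.sum_mul, hx.2, one_mul]

theorem IsLogitQRE.exists_isNash_near (u : ι → (∀ i, A i) → ℝ) {ε : ℝ} (hε : 0 < ε) :
    ∃ M : ℝ, ∀ lam : ℝ, M ≤ lam → ∀ σ : ∀ i, A i → ℝ, IsLogitQRE u lam σ →
      ∃ τ : ∀ i, A i → ℝ, IsNash u τ ∧ ∀ i, ∀ a : A i, |σ i a - τ i a| < ε := by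
  by_contra! h
  choose l hl s hs hfar using fun n : ℕ => h n
  obtain ⟨τ, -, φ, hφ, hτ⟩ := isCompact_setOf_isMixedProfile.tendsto_subseq fun n => (hs n).1
  have hl' : Tendsto l atTop atTop := tendsto_atTop_mono hl tendsto_natCast_atTop_atTop
  have hN : IsNash u τ := isNash_of_tendsto (hl'.comp hφ.tendsto_atTop) (fun n => hs (φ n)) hτ
  obtain ⟨n, hn⟩ := (Metric.tendsto_nhds.1 hτ ε hε).exists
  obtain ⟨i, a, hia⟩ := hfar (φ n) τ hN
  refine hia.not_gt (lt_of_le_of_lt ?_ hn)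
  rw [← Real.dist_eq]
  exact (dist_le_pi_dist (s (φ n) i) (τ i) a).trans (dist_le_pi_dist (s (φ n)) τ i)

theorem exists_isGreatest_actionPayoff (u : ι → (∀ i, A i) → ℝ) (σ : ∀ i, A i → ℝ) (i : ι) :
    ∃ m, IsGreatest (Set.range (actionPayoff u σ i)) m := by
  obtain ⟨a₀, ha₀⟩ := Finite.exists_max (actionPayoff u σ i)
  exact ⟨_, ⟨a₀, rfl⟩, by rintro _ ⟨a, rfl⟩; exact ha₀ a⟩

/-! ### Monotonicity and identification -/

theorem antitone_regret_logitResponse (u : ι → (∀ i, A i) → ℝ) (σ : ∀ i, A i → ℝ) (i : ι) :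
    Antitone fun lam : ℝ => regret u σ i (logitResponse u lam σ i) := by
  simp only [regret_logitResponse]
  exact fun _ _ h => sub_le_sub_left (logit_expectation_mono (fun _ _ hab => hab.le) h) _

theorem strictAnti_regret_logitResponse (u : ι → (∀ i, A i) → ℝ) (σ : ∀ i, A i → ℝ) (i : ι)
    (h : ∃ a b : A i, actionPayoff u σ i a ≠ actionPayoff u σ i b) :
    StrictAnti fun lam : ℝ => regret u σ i (logitResponse u lam σ i) := by
  simp only [regret_logitResponse]
  have hs : ∃ a b : A i, actionPayoff u σ i a < actionPayoff u σ i b ∧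
      actionPayoff u σ i a < actionPayoff u σ i b := by
    obtain ⟨a, b, hab⟩ := h
    rcases hab.lt_or_gt with h | h
    · exact ⟨a, b, h, h⟩
    · exact ⟨b, a, h, h⟩
  exact fun _ _ h => sub_lt_sub_left (logit_expectation_strictMono (fun _ _ hab => hab.le) hs h) _

theorem antitone_distToBestResponse_logitResponse (u : ι → (∀ i, A i) → ℝ)
    (σ : ∀ i, A i → ℝ) (i : ι) :
    Antitone fun lam : ℝ => distToBestResponse u σ i (logitResponse u lam σ i) := by
  obtain ⟨m, hm⟩ := exists_isGreatest_actionPayoff u σ i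
  simp only [fun lam => distToBestResponse_eq u σ i hm (isMixedProfile_logitResponse u lam σ i)]
  exact fun _ _ h => sub_le_sub_left
    (logit_expectation_mono (fun _ _ hab => argmax_indicator_mono hm hab) h) _

theorem strictAnti_distToBestResponse_logitResponse (u : ι → (∀ i, A i) → ℝ)
    (σ : ∀ i, A i → ℝ) (i : ι) (h : ∃ a b : A i, actionPayoff u σ i a ≠ actionPayoff u σ i b) :
    StrictAnti fun lam : ℝ => distToBestResponse u σ i (logitResponse u lam σ i) := by
  obtain ⟨m, hm⟩ := exists_isGreatest_actionPayoff u σ i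
  simp only [fun lam => distToBestResponse_eq u σ i hm (isMixedProfile_logitResponse u lam σ i)]
  have hs : ∃ a b : A i, actionPayoff u σ i a < actionPayoff u σ i b ∧
      (if actionPayoff u σ i a = m then 1 else 0 : ℝ) <
        if actionPayoff u σ i b = m then 1 else 0 := by
    obtain ⟨b, hb⟩ := hm.1
    obtain ⟨a, ha⟩ : ∃ a, actionPayoff u σ i a ≠ m := by
      by_contra! hall
      obtain ⟨a, b, hab⟩ := h
      exact hab ((hall a).trans (hall b).symm)
    exact ⟨a, b, hb ▸ (hm.2 ⟨a, rfl⟩).lt_of_ne ha, by simp [ha, hb]⟩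
  exact fun _ _ h => sub_lt_sub_left
    (logit_expectation_strictMono (fun _ _ hab => argmax_indicator_mono hm hab) hs h) _

theorem strictMono_logitResponse_div (u : ι → (∀ i, A i) → ℝ) (σ : ∀ i, A i → ℝ) (i : ι)
    {a b : A i} (hab : actionPayoff u σ i b < actionPayoff u σ i a) :
    StrictMono fun lam : ℝ => logitResponse u lam σ i a / logitResponse u lam σ i b := by
  intro lam mu h
  simp only [logitResponse, logit_ratio]
  exact Real.exp_lt_exp.2 (mul_lt_mul_of_pos_right h (sub_pos.2 hab))

theorem injective_logitResponse (u : ι → (∀ i, A i) → ℝ) (σ : ∀ i, A i → ℝ) (i : ι)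
    (h : ∃ a b : A i, actionPayoff u σ i a ≠ actionPayoff u σ i b) :
    Function.Injective fun lam : ℝ => logitResponse u lam σ i := by
  have hs : ∃ a b : A i, actionPayoff u σ i b < actionPayoff u σ i a := by
    obtain ⟨a, b, hab⟩ := h
    rcases hab.lt_or_gt with h | h
    exacts [⟨b, a, h⟩, ⟨a, b, h⟩]
  obtain ⟨a, b, hab⟩ := hs
  intro lam mu heq
  refine (strictMono_logitResponse_div u σ i hab).injective ?_
  simp only [show logitResponse u lam σ i = logitResponse u mu σ i from heq]

end FiniteGame

open FiniteGame in
theorem theorem5 {ι : Type*} {A : ι → Type*} [Fintype ι] [DecidableEq ι]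
    [∀ i, Fintype (A i)] [∀ i, DecidableEq (A i)] [∀ i, Nonempty (A i)]
    (u : ι → (∀ i, A i) → ℝ) :
    -- existence
    (∀ lam : ℝ, 0 ≤ lam → ∃ σ : ∀ i, A i → ℝ, IsLogitQRE u lam σ) ∧
    -- limit at zero: all equilibria tend to the uniform profile
    (∀ ε : ℝ, 0 < ε → ∃ δ : ℝ, 0 < δ ∧ ∀ lam : ℝ, 0 ≤ lam → lam < δ →
      ∀ σ : ∀ i, A i → ℝ, IsLogitQRE u lam σ →
        ∀ i, ∀ a : A i, |σ i a - uniformProfile i a| < ε) ∧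
    -- limit at infinity: all equilibria tend to the set of Nash equilibria
    (∀ ε : ℝ, 0 < ε → ∃ M : ℝ, ∀ lam : ℝ, M ≤ lam →
      ∀ σ : ∀ i, A i → ℝ, IsLogitQRE u lam σ →
        ∃ τ : ∀ i, A i → ℝ, IsNash u τ ∧ ∀ i, ∀ a : A i, |σ i a - τ i a| < ε) ∧
    -- limit at infinity: every limit point of equilibria is a Nash equilibrium
    (∀ (l : ℕ → ℝ) (s : ℕ → ∀ i, A i → ℝ) (τ : ∀ i, A i → ℝ),
      Tendsto l atTop atTop → (∀ n, IsLogitQRE u (l n) (s n)) → Tendsto s atTop (𝓝 τ) →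
        IsNash u τ) ∧
    -- monotonicity: a higher parameter brings the response closer to best response
    (∀ σ : ∀ i, A i → ℝ, IsMixedProfile σ → ∀ i,
      AntitoneOn (fun lam : ℝ => regret u σ i (logitResponse u lam σ i)) (Set.Ici 0) ∧
      AntitoneOn (fun lam : ℝ => distToBestResponse u σ i (logitResponse u lam σ i))
        (Set.Ici 0) ∧
      ((∃ a b : A i, actionPayoff u σ i a ≠ actionPayoff u σ i b) →
        StrictAntiOn (fun lam : ℝ => regret u σ i (logitResponse u lam σ i)) (Set.Ici 0) ∧
        StrictAntiOn (fun lam : ℝ => distToBestResponse u σ i (logitResponse u lam σ i))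
          (Set.Ici 0))) ∧
    -- strict monotonicity of the logit map, and identification from one player's choices
    (∀ σ : ∀ i, A i → ℝ, IsMixedProfile σ → ∀ i,
      (∀ a b : A i, actionPayoff u σ i b < actionPayoff u σ i a →
        StrictMonoOn (fun lam : ℝ => logitResponse u lam σ i a / logitResponse u lam σ i b)
          (Set.Ici 0)) ∧
      ((∃ a b : A i, actionPayoff u σ i a ≠ actionPayoff u σ i b) →
        Set.InjOn (fun lam : ℝ => logitResponse u lam σ i) (Set.Ici 0))) ∧
    -- identification from the distribution of equilibrium play
    (∀ (lam lam' : ℝ) (σ σ' : ∀ i, A i → ℝ), 0 ≤ lam → 0 ≤ lam' →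
      IsLogitQRE u lam σ → IsLogitQRE u lam' σ' →
      (∃ i, ∃ a b : A i, actionPayoff u σ i a ≠ actionPayoff u σ i b) →
      (∀ b : ∀ i, A i, playProb σ b = playProb σ' b) → lam = lam') := by
  refine ⟨fun lam _ => exists_isLogitQRE u lam,
    fun ε hε => IsLogitQRE.exists_forall_abs_sub_uniformProfile_lt u hε,
    fun ε hε => IsLogitQRE.exists_isNash_near u hε,
    fun l s τ hl hs hτ => isNash_of_tendsto hl hs hτ,
    fun σ _ i => ⟨(antitone_regret_logitResponse u σ i).antitoneOn _,
      (antitone_distToBestResponse_logitResponse u σ i).antitoneOn _,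
      fun h => ⟨(strictAnti_regret_logitResponse u σ i h).strictAntiOn _,
        (strictAnti_distToBestResponse_logitResponse u σ i h).strictAntiOn _⟩⟩,
    fun σ _ i => ⟨fun a b hab => (strictMono_logitResponse_div u σ i hab).strictMonoOn _,
      fun h => (injective_logitResponse u σ i h).injOn⟩, ?_⟩
  rintro lam lam' σ σ' - - hσ hσ' ⟨i, hi⟩ hplay
  obtain rfl := hσ.1.eq_of_playProb_eq hσ'.1 hplay
  refine injective_logitResponse u σ i hi ?_
  simp only [hσ.2.eq, hσ'.2.eq]
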